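/- Let $n$ be a cardinal with $1\le n\le\aleph_0$, let $\mathbb F_n^+$ be the free monoid on generators $g_1,g_2,\dots$ ($n$ of them), and let $\mathcal F^2$ be the full Fock space of an $n$-dimensional Hilbert space, with its orthonormal basis $\{e_\alpha\}_{\alpha\in\mathbb F_n^+}$ and its left creation operators $S_i e_\alpha=e_{g_i\alpha}$. Let $F^\infty\subset B(\mathcal F^2)$ be the closure, in the weak operator topology (WOT), of the norm-closed algebra generated by the $S_i$ and the identity. For operators $T_i$ on a Hilbert space and $\alpha=g_{i_1}\cdots g_{i_k}$ write $T_\alpha=T_{i_1}\cdots T_{i_k}$, $|\alpha|=k$ (and $T_\alpha=I$ for the empty word). Let $\mathcal H$ be a complex Hilbert space and let $T=[T_1,T_2,\dots]$, $T_i\in B(\mathcal H)$, be a $C_0$-contraction, that is, $\sum_i T_iT_i^*\le I$ and $\sum_{|\alpha|=k}T_\alpha T_\alpha^*\to0$ strongly as $k\to\infty$. Put $\Delta=(I-\sum_i T_iT_i^*)^{1/2}$, let $K_T:\mathcal H\to\mathcal F^2\otimes\mathcal H$, $K_Th=\sum_{\alpha}e_\alpha\otimes\Delta T_\alpha^*h$,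 be the Poisson kernel of $T$, and for $\varphi\in F^\infty$ let $\varphi(T)=K_T^*(\varphi\otimes I_{\mathcal H})K_T$ be the $F^\infty$-functional calculus of $T$. Let $J$ be a WOT-closed two-sided ideal of $F^\infty$ with $\varphi(T)=0$ for every $\varphi\in J$. Let $\mathcal M_J$ be the closed linear span of $\{\varphi\psi:\varphi\in J,\ \psi\in\mathcal F^2\}$, let $\mathcal N_J=\mathcal F^2\ominus\mathcal M_J$, and let $B_i=P_{\mathcal N_J}S_i|_{\mathcal N_J}$. Then $K_T$ takes values in $\mathcal N_J\otimes\mathcal H$, and, with $K:\mathcal H\to\mathcal N_J\otimes\mathcal H$ denoting $K_T$ regarded as a map into $\mathcal N_J\otimes\mathcal H$, the linear map $\Phi:B(\mathcal N_J)\to B(\mathcal H)$, $\Phi(A)=K^*(A\otimes I_{\mathcal H})K$, is unital, completely contractive and $w^*$-continuous, and satisfies $$\Phi(B_\alpha B_\beta^*)=T_\alpha T_\beta^*\qquad\text{for all }\alpha,\beta\in\mathbb F_n^+ .$$ -/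

import Mathlib

open scoped TensorProduct InnerProductSpace Topology
open ContinuousLinearMap (adjoint)

noncomputable section

namespace Popescu

/-! ### The full Fock space and the left creation operators -/

/-- The full Fock space over a Hilbert space with orthonormal basis `(e_i)_{i ∈ ι}`, in the
coordinates of its orthonormal basis `(e_α)`, `α` in the free monoid on `ι`: the summand of degree
`k` is the closed span of the `e_α` with `|α| = k`. -/
abbrev Fock (ι : Type*) : Type _ := lp (fun _ : FreeMonoid ι => ℂ) 2

open Classical in
/-- The basis vector `e_α = e_{i₁} ⊗ ⋯ ⊗ e_{i_k}` for `α = g_{i₁} ⋯ g_{i_k}`. -/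
def e {ι : Type*} (α : FreeMonoid ι) : Fock ι := lp.single 2 α (1 : ℂ)

theorem orthonormal_e (ι : Type*) : Orthonormal ℂ (e : FreeMonoid ι → Fock ι) := by
  classical
  have h := (HilbertBasis.ofRepr (LinearIsometryEquiv.refl ℂ (Fock ι))).orthonormal
  convert! h using 1

theorem orthonormal_e_mul {ι : Type*} (i : ι) :
    Orthonormal ℂ (fun α : FreeMonoid ι => (e (FreeMonoid.of i * α) : Fock ι)) :=
  (orthonormal_e ι).comp _ (mul_right_injective _)

/-- The left creation operator `S_i ψ = e_i ⊗ ψ`, that is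
`S_i (∑ a_α e_α) = ∑ a_α e_{g_i α}`. -/
def creation {ι : Type*} (i : ι) : Fock ι →L[ℂ] Fock ι :=
  (orthonormal_e_mul i).orthogonalFamily.linearIsometry.toContinuousLinearMap

/-- `T_α = T_{i₁} ⋯ T_{i_k}` for `α = g_{i₁} ⋯ g_{i_k}`, and `T_α = I` for the empty word. -/
def word {ι M : Type*} [Monoid M] (T : ι → M) (α : FreeMonoid ι) : M := FreeMonoid.lift T α

/-- The noncommutative disc algebra: the norm closed algebra generated by the creation operators
and the identity. -/
def discAlgebra (ι : Type*) : Subalgebra ℂ (Fock ι →L[ℂ] Fock ι) :=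
  (Algebra.adjoin ℂ (Set.range creation)).topologicalClosure

/-- The algebra `F^∞`: the closure of the noncommutative disc algebra in the weak operator
topology. -/
def FInf (ι : Type*) : Subalgebra ℂ (Fock ι →WOT[ℂ] Fock ι) :=
  ((discAlgebra ι).map
    (ContinuousLinearMapWOT.algEquiv ℂ).symm.toAlgHom).topologicalClosure

/-! ### The subspaces attached to an ideal of `F^∞` -/

/-- `M_J`, the closed subspace spanned by the vectors `φ ⊗ ψ = φ(S) ψ`, `φ ∈ J`. -/
def MJ {ι : Type*} (J : TwoSidedIdeal (FInf ι)) : Submodule ℂ (Fock ι) :=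
  (Submodule.span ℂ
    {x | ∃ φ ∈ J, ∃ ψ : Fock ι, x = (φ : Fock ι →WOT[ℂ] Fock ι) ψ}).topologicalClosure

/-- `N_J`, the orthogonal complement of `M_J` in the Fock space. -/
abbrev NJ {ι : Type*} (J : TwoSidedIdeal (FInf ι)) : Submodule ℂ (Fock ι) := (MJ J)ᗮ

/-- The compression `P_N A|_N` of an operator to a closed subspace. -/
def compression {E : Type*} [NormedAddCommGroup E] [InnerProductSpace ℂ E]
    (N : Submodule ℂ E) [N.HasOrthogonalProjection] (A : E →L[ℂ] E) : N →L[ℂ] N :=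
  N.orthogonalProjectionOnto ∘L A ∘L N.subtypeL

/-- The compressions `B_i = P_{N_J} S_i|_{N_J}`. -/
def B {ι : Type*} (J : TwoSidedIdeal (FInf ι)) (i : ι) : NJ J →L[ℂ] NJ J :=
  compression (NJ J) (creation i)

/-! ### Hilbert space tensor products -/

section Tensor

variable {E E' H : Type*} [NormedAddCommGroup E] [InnerProductSpace ℂ E]
  [NormedAddCommGroup E'] [InnerProductSpace ℂ E']
  [NormedAddCommGroup H] [InnerProductSpace ℂ H]

/-- The Hilbert space tensor product: the completion of the algebraic tensor product. -/
abbrev HilbertTensor (E H : Type*) [NormedAddCommGroup E] [InnerProductSpace ℂ E]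
    [NormedAddCommGroup H] [InnerProductSpace ℂ H] : Type _ :=
  UniformSpace.Completion (E ⊗[ℂ] H)

/-- The elementary tensor `x ⊗ h` in the Hilbert space tensor product. -/
def tmulH (x : E) (h : H) : HilbertTensor E H := ((x ⊗ₜ[ℂ] h : E ⊗[ℂ] H) : HilbertTensor E H)

variable (H) in
/-- The bounded operator `A ⊗ I_H`: the continuous extension of `x ⊗ h ↦ A x ⊗ h`. -/
def tensorId (A : E →L[ℂ] E') : HilbertTensor E H →L[ℂ] HilbertTensor E' H :=
  (UniformSpace.Completion.toComplL ∘L A.rTensor H).extend UniformSpace.Completion.toComplL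

theorem tensorId_tmulH (A : E →L[ℂ] E') (x : E) (h : H) :
    tensorId H A (tmulH x h) = tmulH (A x) h :=
  ContinuousLinearMap.extend_eq (𝕜 := ℂ) (𝕜₂ := ℂ) (e := UniformSpace.Completion.toComplL)
    (UniformSpace.Completion.toComplL ∘L A.rTensor H)
    (UniformSpace.Completion.denseRange_coe)
    (UniformSpace.Completion.isUniformInducing_coe _) (x ⊗ₜ[ℂ] h)

/-- The isometry `h ↦ e_α ⊗ h`. -/
def basisTensor {ι : Type*} (α : FreeMonoid ι) :
    H →ₗᵢ[ℂ] HilbertTensor (Fock ι) H where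
  toFun h := tmulH (e α) h
  map_add' x y := by
    simp only [tmulH, TensorProduct.tmul_add, UniformSpace.Completion.coe_add]
  map_smul' c x := by
    simp only [tmulH, TensorProduct.tmul_smul, UniformSpace.Completion.coe_smul, RingHom.id_apply]
  norm_map' x := by
    change ‖tmulH (e α) x‖ = ‖x‖
    rw [tmulH, UniformSpace.Completion.norm_coe, TensorProduct.norm_tmul,
      (orthonormal_e ι).1 α, one_mul]

theorem orthogonalFamily_basisTensor {ι : Type*} :
    OrthogonalFamily ℂ (fun _ : FreeMonoid ι => H) (fun α => basisTensor α) := by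
  intro α β hαβ x y
  change ⟪tmulH (e α) x, tmulH (e β) y⟫_ℂ = 0
  rw [tmulH, tmulH, UniformSpace.Completion.inner_coe, TensorProduct.inner_tmul,
    (orthonormal_e ι).2 hαβ, zero_mul]

end Tensor

/-! ### Row contractions and the noncommutative Poisson kernel -/

section Poisson

variable {ι H : Type*} [NormedAddCommGroup H] [InnerProductSpace ℂ H] [CompleteSpace H]

/-- `T = [T_i]_{i ∈ ι}` is a row contraction: `∑ T_i T_i^* ≤ I`. The terms are positive, so this
means that all finite partial sums are at most `I`. -/
def IsRowContraction (T : ι → H →L[ℂ] H) : Prop :=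
  ∀ s : Finset ι, ∑ i ∈ s, T i ∘L adjoint (T i) ≤ 1

/-- `T = [T_i]_{i ∈ ι}` is a `C_0`-contraction: it is a row contraction and
`∑_{|α| = k} T_α T_α^* → 0` in the strong operator topology as `k → ∞`, the sums being
convergent in the strong operator topology too. -/
structure IsC0Contraction (T : ι → H →L[ℂ] H) : Prop where
  isRowContraction : IsRowContraction T
  tendsto_zero : ∀ h : H, Filter.Tendsto
    (fun k : ℕ => ∑' α : {α : FreeMonoid ι // α.length = k},
      (word T α.1) (adjoint (word T α.1) h)) Filter.atTop (𝓝 0)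

variable {T : ι → H →L[ℂ] H}

theorem IsRowContraction.sum_le (hT : IsRowContraction T) (h : H) (s : Finset ι) :
    ∑ i ∈ s, ‖adjoint (T i) h‖ ^ 2 ≤ ‖h‖ ^ 2 := by
  have h1 := (ContinuousLinearMap.le_def _ _).1 (hT s)
  have h2 := h1.re_inner_nonneg_right h
  have h3 : ∀ i, ⟪h, T i (adjoint (T i) h)⟫_ℂ = ⟪adjoint (T i) h, adjoint (T i) h⟫_ℂ :=
    fun i => (ContinuousLinearMap.adjoint_inner_left (T i) (adjoint (T i) h) h).symm
  simp only [sub_apply, one_apply_eq_self, sum_apply, ContinuousLinearMap.comp_apply,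
    inner_sub_right, inner_sum, h3, map_sub, map_sum, inner_self_eq_norm_sq] at h2
  linarith

theorem IsRowContraction.memℓp (hT : IsRowContraction T) (h : H) :
    Memℓp (fun i => adjoint (T i) h) 2 :=
  memℓp_gen' (C := ‖h‖ ^ 2) fun s => by simpa using hT.sum_le h s

/-- The adjoint `h ↦ (T_i^* h)_i` of the row operator `[T_i] : ⨁ H → H`. -/
def columnOp (T : ι → H →L[ℂ] H) (hT : IsRowContraction T) :
    H →L[ℂ] lp (fun _ : ι => H) 2 :=
  LinearMap.mkContinuous
    { toFun := fun h => ⟨fun i => adjoint (T i) h, hT.memℓp h⟩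
      map_add' := fun x y => by ext i; simp; rfl
      map_smul' := fun c x => by ext i; simp } 1 fun h => by
    rw [one_mul]
    refine lp.norm_le_of_forall_sum_le (by norm_num) (norm_nonneg _) fun s => ?_
    simpa using hT.sum_le h s

/-- The row operator `[T_i] : ⨁ H → H`, `(x_i) ↦ ∑ T_i x_i`. -/
def rowOp (T : ι → H →L[ℂ] H) (hT : IsRowContraction T) :
    lp (fun _ : ι => H) 2 →L[ℂ] H :=
  adjoint (columnOp T hT)

theorem hasSum_rowOp (hT : IsRowContraction T) (x : lp (fun _ : ι => H) 2) :
    HasSum (fun i => T i (x i)) (rowOp T hT x) := by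
  classical
  have h1 : ∀ i, rowOp T hT (lp.single 2 i (x i)) = T i (x i) := fun i => by
    refine ext_inner_left ℂ fun v => ?_
    rw [rowOp, ContinuousLinearMap.adjoint_inner_right, lp.inner_single_right,
      ← ContinuousLinearMap.adjoint_inner_left]
    rfl
  simpa only [h1] using (rowOp T hT).hasSum (lp.hasSum_single (by norm_num) x)

/-- The defect operator `Δ = (I - ∑ T_i T_i^*)^{1/2} = (I - T T^*)^{1/2}`. -/
def defect (T : ι → H →L[ℂ] H) (hT : IsRowContraction T) : H →L[ℂ] H :=
  CFC.sqrt (1 - rowOp T hT ∘L adjoint (rowOp T hT))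

theorem norm_defect_sq (hT : IsRowContraction T) (h : H) (s : Finset ι) :
    ‖defect T hT h‖ ^ 2 + ∑ i ∈ s, ‖adjoint (T i) h‖ ^ 2 ≤ ‖h‖ ^ 2 := by
  have hC : ‖columnOp T hT‖ ≤ 1 := LinearMap.mkContinuous_norm_le _ zero_le_one _
  have h0 : adjoint (rowOp T hT) = columnOp T hT := ContinuousLinearMap.adjoint_adjoint _
  have hin : ∀ x, ⟪x, (1 - rowOp T hT ∘L adjoint (rowOp T hT)) x⟫_ℂ =
      ((‖x‖ ^ 2 - ‖columnOp T hT x‖ ^ 2 : ℝ) : ℂ) := fun x => by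
    rw [h0, sub_apply, one_apply_eq_self, inner_sub_right, ContinuousLinearMap.comp_apply, rowOp,
      ContinuousLinearMap.adjoint_inner_right, inner_self_eq_norm_sq_to_K,
      inner_self_eq_norm_sq_to_K]
    push_cast
    rfl
  have hpos : 0 ≤ 1 - rowOp T hT ∘L adjoint (rowOp T hT) := by
    rw [ContinuousLinearMap.nonneg_iff_isPositive, ContinuousLinearMap.isPositive_iff_complex]
    intro x
    have h2 : ‖columnOp T hT x‖ ≤ ‖x‖ := by
      simpa using (columnOp T hT).le_of_opNorm_le hC x
    rw [← inner_conj_symm, hin, Complex.conj_ofReal]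
    refine ⟨rfl, ?_⟩
    have : ‖columnOp T hT x‖ ^ 2 ≤ ‖x‖ ^ 2 := by gcongr
    change (0 : ℝ) ≤ ‖x‖ ^ 2 - ‖columnOp T hT x‖ ^ 2
    linarith
  have hsa : adjoint (defect T hT) = defect T hT :=
    (IsSelfAdjoint.of_nonneg (CFC.sqrt_nonneg _)).star_eq
  have h4 : ‖defect T hT h‖ ^ 2 = ‖h‖ ^ 2 - ‖columnOp T hT h‖ ^ 2 := by
    have h5 : ⟪h, (defect T hT * defect T hT) h⟫_ℂ = ((‖defect T hT h‖ ^ 2 : ℝ) : ℂ) := by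
      rw [mul_apply_eq_comp, ← ContinuousLinearMap.adjoint_inner_left, hsa,
        inner_self_eq_norm_sq_to_K]
      push_cast
      rfl
    rw [defect, CFC.sqrt_mul_sqrt_self _ hpos, hin] at h5
    exact (Complex.ofReal_injective h5).symm
  have h6 : ∑ i ∈ s, ‖adjoint (T i) h‖ ^ 2 ≤ ‖columnOp T hT h‖ ^ 2 := by
    have := lp.sum_rpow_le_norm_rpow (p := 2) (by norm_num) (columnOp T hT h) s
    simp only [ENNReal.toReal_ofNat, Real.rpow_ofNat] at this
    exact this
  linarith

theorem sum_norm_defect_le (hT : IsRowContraction T) (k : ℕ) : ∀ (h : H)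
    (s : Finset (FreeMonoid ι)), (∀ α ∈ s, α.length < k) →
      ∑ α ∈ s, ‖defect T hT (adjoint (word T α) h)‖ ^ 2 ≤ ‖h‖ ^ 2 := by
  classical
  induction k with
  | zero =>
    intro h s hs
    rw [Finset.eq_empty_of_forall_notMem (s := s) fun α hα => absurd (hs α hα) (by simp)]
    simp
  | succ k ih =>
    intro h s hs
    let s' : Finset (FreeMonoid ι) := s.erase 1
    let I : Finset ι := (s'.toList.map FreeMonoid.toList).flatten.toFinset
    let R : Finset (FreeMonoid ι) := s'.image fun α => FreeMonoid.ofList α.toList.tail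
    have hR : ∀ α ∈ R, α.length < k := by
      intro α hα
      obtain ⟨β, hβ, rfl⟩ := Finset.mem_image.1 hα
      obtain ⟨h1, h2⟩ := Finset.mem_erase.1 hβ
      have h3 : List.length β < k + 1 := hs β h2
      have h4 := List.length_pos_of_ne_nil h1
      have h5 : (FreeMonoid.toList β).tail.length = (FreeMonoid.toList β).length - 1 :=
        List.length_tail
      change (FreeMonoid.toList β).tail.length < k
      change (FreeMonoid.toList β).length < k + 1 at h3
      change 0 < (FreeMonoid.toList β).length at h4
      omega
    have hsub : s ⊆ insert 1 ((I ×ˢ R).image fun p => FreeMonoid.of p.1 * p.2) := by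
      intro α hα
      rcases hα' : FreeMonoid.toList α with _ | ⟨i, β⟩
      · exact Finset.mem_insert.2 (Or.inl hα')
      · have hmem : α ∈ s' := by
          refine Finset.mem_erase.2 ⟨?_, hα⟩
          rintro rfl
          exact List.cons_ne_nil _ _ hα'.symm
        refine Finset.mem_insert_of_mem (Finset.mem_image.2 ⟨(i, β), ?_, hα'.symm⟩)
        refine Finset.mem_product.2 ⟨?_, Finset.mem_image.2 ⟨α, hmem, ?_⟩⟩
        swap
        · rw [hα']; rfl
        exact List.mem_toFinset.2 (List.mem_flatten.2
          ⟨_, List.mem_map.2 ⟨α, Finset.mem_toList.2 hmem, hα'⟩, List.mem_cons_self⟩)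
    have hw : ∀ i (β : FreeMonoid ι), adjoint (word T (FreeMonoid.of i * β)) h =
        adjoint (word T β) (adjoint (T i) h) := fun i β => by
      rw [word, map_mul, FreeMonoid.lift_eval_of, ContinuousLinearMap.mul_def,
        ContinuousLinearMap.adjoint_comp]
      rfl
    have h1 : adjoint (word T (1 : FreeMonoid ι)) h = h := by
      rw [word, map_one, ← ContinuousLinearMap.star_eq_adjoint, star_one, one_apply_eq_self]
    calc ∑ α ∈ s, ‖defect T hT (adjoint (word T α) h)‖ ^ 2
        ≤ ∑ α ∈ insert 1 ((I ×ˢ R).image fun p => FreeMonoid.of p.1 * p.2),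
            ‖defect T hT (adjoint (word T α) h)‖ ^ 2 :=
          Finset.sum_le_sum_of_subset_of_nonneg hsub fun _ _ _ => sq_nonneg _
      _ ≤ ‖defect T hT h‖ ^ 2 + ∑ α ∈ (I ×ˢ R).image fun p => FreeMonoid.of p.1 * p.2,
            ‖defect T hT (adjoint (word T α) h)‖ ^ 2 := by
          rw [Finset.sum_insert, h1]
          intro hc
          obtain ⟨p, -, hp⟩ := Finset.mem_image.1 hc
          exact List.cons_ne_nil _ _ hp
      _ ≤ ‖defect T hT h‖ ^ 2 + ∑ i ∈ I, ‖adjoint (T i) h‖ ^ 2 := by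
          rw [Finset.sum_image, Finset.sum_product]
          · refine add_le_add_right (Finset.sum_le_sum fun i _ => ?_) _
            simp only [hw]
            exact ih _ R hR
          · rintro ⟨i, β⟩ - ⟨j, γ⟩ - hij
            obtain ⟨rfl, rfl⟩ := List.cons.inj hij
            rfl
      _ ≤ ‖h‖ ^ 2 := norm_defect_sq hT h I

/-- The family `(Δ T_α^* h)_α` is square summable. -/
def poissonCoeff (hT : IsRowContraction T) (h : H) : lp (fun _ : FreeMonoid ι => H) 2 :=
  ⟨fun α => defect T hT (adjoint (word T α) h), memℓp_gen' (C := ‖h‖ ^ 2) fun s => by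
    simpa using sum_norm_defect_le hT (s.sup FreeMonoid.length + 1) h s
      fun α hα => Nat.lt_succ_of_le (Finset.le_sup (f := FreeMonoid.length) hα)⟩

theorem norm_poissonCoeff_le (hT : IsRowContraction T) (h : H) : ‖poissonCoeff hT h‖ ≤ ‖h‖ :=
  lp.norm_le_of_forall_sum_le (by norm_num) (norm_nonneg _) fun s => by
    simp only [ENNReal.toReal_ofNat, Real.rpow_ofNat]
    exact sum_norm_defect_le hT (s.sup FreeMonoid.length + 1) h s
      fun α hα => Nat.lt_succ_of_le (Finset.le_sup (f := FreeMonoid.length) hα)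

theorem summable_poisson (hT : IsRowContraction T) (h : H) :
    Summable fun α : FreeMonoid ι => tmulH (e α) (defect T hT (adjoint (word T α) h)) :=
  orthogonalFamily_basisTensor.summable_of_lp (poissonCoeff hT h)

/-- The noncommutative Poisson kernel `K h = ∑_α e_α ⊗ Δ T_α^* h`. -/
def ncPoissonKernel (T : ι → H →L[ℂ] H) (hT : IsRowContraction T) :
    H →L[ℂ] HilbertTensor (Fock ι) H :=
  LinearMap.mkContinuous
    { toFun := fun h => ∑' α : FreeMonoid ι, tmulH (e α) (defect T hT (adjoint (word T α) h))
      map_add' := fun x y => by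
        rw [← (summable_poisson hT x).tsum_add (summable_poisson hT y)]
        refine tsum_congr fun α => ?_
        rw [map_add, map_add]
        exact (basisTensor α).map_add _ _
      map_smul' := fun c x => by
        rw [RingHom.id_apply, ← (summable_poisson hT x).tsum_const_smul]
        refine tsum_congr fun α => ?_
        rw [map_smul, map_smul]
        exact (basisTensor α).map_smul _ _ } 1 fun h => by
    rw [one_mul]
    refine le_trans (le_of_eq ?_) (norm_poissonCoeff_le hT h)
    exact orthogonalFamily_basisTensor.linearIsometry.norm_map (poissonCoeff hT h)

/-- The Poisson transform `Ψ(A) = K^* (A ⊗ I) K` on the operators on the Fock space. -/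
def ncPoissonTransform (T : ι → H →L[ℂ] H) (hT : IsRowContraction T) (A : Fock ι →L[ℂ] Fock ι) :
    H →L[ℂ] H :=
  adjoint (ncPoissonKernel T hT) ∘L tensorId H A ∘L ncPoissonKernel T hT

/-- The `F^∞`-functional calculus `φ ↦ φ(T)` of a `C_0`-contraction: the restriction to `F^∞` of
the Poisson transform. -/
def evalAt (T : ι → H →L[ℂ] H) (hT : IsC0Contraction T) (φ : FInf ι) : H →L[ℂ] H :=
  ncPoissonTransform T hT.isRowContraction (φ : Fock ι →WOT[ℂ] Fock ι).toCLM

end Poisson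

/-! ### Maps between algebras of operators -/

section Maps

variable {E H : Type*} [NormedAddCommGroup E] [InnerProductSpace ℂ E]
  [NormedAddCommGroup H] [InnerProductSpace ℂ H]

/-- The operator on the Hilbert space `H^m` given by an `m × m` matrix of operators on `H`. -/
def blockOp {m : ℕ} (M : Matrix (Fin m) (Fin m) (H →L[ℂ] H)) :
    PiLp 2 (fun _ : Fin m => H) →L[ℂ] PiLp 2 (fun _ : Fin m => H) :=
  (PiLp.continuousLinearEquiv 2 ℂ (fun _ : Fin m => H)).symm.toContinuousLinearMap ∘L
    ContinuousLinearMap.pi fun i => ∑ j, M i j ∘L PiLp.proj 2 (fun _ : Fin m => H) j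

/-- `Φ` is completely contractive: all its matrix amplifications are contractive, where the
`m × m` matrices over `B(H)` are normed as operators on `H^m`. -/
def IsCompletelyContractive (Φ : (E →L[ℂ] E) →ₗ[ℂ] (H →L[ℂ] H)) : Prop :=
  ∀ (m : ℕ) (M : Matrix (Fin m) (Fin m) (E →L[ℂ] E)), ‖blockOp (M.map Φ)‖ ≤ ‖blockOp M‖

/-- The `w^*`-topology of `B(H)` as the dual of the trace class operators (the ultraweak topology):
the trace class operators are the sums `∑ x_k ⊗ y_k^*` with `(x_k)`, `(y_k)` square summable, and
such an operator pairs with `A` to `∑ ⟨A x_k, y_k⟩`. -/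
@[reducible]
def weakStarTopology (H : Type*) [NormedAddCommGroup H] [InnerProductSpace ℂ H] :
    TopologicalSpace (H →L[ℂ] H) :=
  TopologicalSpace.induced
    (fun (A : H →L[ℂ] H) (p : lp (fun _ : ℕ => H) 2 × lp (fun _ : ℕ => H) 2) =>
      ∑' k, ⟪p.2 k, A (p.1 k)⟫_ℂ) Pi.topologicalSpace

/-- Continuity with respect to the `w^*`-topologies. -/
def IsWeakStarContinuous (Φ : (E →L[ℂ] E) → (H →L[ℂ] H)) : Prop :=
  @Continuous _ _ (weakStarTopology E) (weakStarTopology H) Φ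

end Maps

end Popescu

end

open Popescu

open scoped TensorProduct InnerProductSpace Topology
open ContinuousLinearMap (adjoint)

noncomputable section

namespace Popescu

/-! ### Operators on Hilbert space tensor products -/

section TensorOperators

variable {E E' E'' H F : Type*} [NormedAddCommGroup E] [InnerProductSpace ℂ E]
  [NormedAddCommGroup E'] [InnerProductSpace ℂ E']
  [NormedAddCommGroup E''] [InnerProductSpace ℂ E'']
  [NormedAddCommGroup H] [InnerProductSpace ℂ H]
  [NormedAddCommGroup F] [NormedSpace ℂ F]

/-! Everything rests on three facts about the Poisson kernel $K_T$. It is isometric. The identity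
$\|x\|^2=\|\Delta x\|^2+\sum_i\|T_i^*x\|^2$ telescopes along word length to
$\|h\|^2=\sum_{|\alpha|<k}\|\Delta T_\alpha^*h\|^2+\sum_{|\alpha|=k}\|T_\alpha^*h\|^2$, and the last
sum tends to $0$ by the $C_0$ condition (`norm_ncPoissonKernel`). It intertwines:
$(S_\alpha^*\otimes I)K_T=K_TT_\alpha^*$ (`tensorId_adjoint_word_creation`). Its range lies in
$\mathcal N_J\otimes\mathcal H$, that is, $K_Th\perp\varphi\psi\otimes k$ for $\varphi\in J$. By
density $\psi=e_\alpha=S_\alpha e_1$, and $A=\varphi S_\alpha$ is again in $J$, so it suffices to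
treat $Ae_1\otimes k$. Since $K_Th$ lies in $\mathcal F^2$ tensored with the closure of the range of
$\Delta$, one may take $k=\Delta y$. Tested against vectors, $e_1\otimes\Delta
y=K_Ty-\sum_i(S_i\otimes I)K_TT_i^*y$, so the inner product reduces to matrix coefficients of the
Poisson transforms of $A$ and $AS_i$, which vanish (`inner_tmulH_apply_e_one_eq_zero`).
Multiplicativity of the functional calculus is not needed.

As $\mathcal M_J$ is invariant under each $S_i$, $B_i^*$ is the restriction of $S_i^*$, so
$(B_\alpha^*\otimes I)K=KT_\alpha^*$ and $K^*(B_\alpha B_\beta^*\otimes I)K=T_\alpha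
K^*KT_\beta^*=T_\alpha T_\beta^*$. Complete contractivity and $w^*$-continuity hold for any
$A\mapsto K^*(A\otimes I)K$ with $\|K\|\le1$: an orthonormal basis of $\mathcal H$ turns $A\otimes
I$ into copies of $A$ (`slice_tensorId`). -/

theorem inner_tmulH (x y : E) (h k : H) :
    ⟪tmulH x h, tmulH y k⟫_ℂ = ⟪x, y⟫_ℂ * ⟪h, k⟫_ℂ := by
  rw [tmulH, tmulH, UniformSpace.Completion.inner_coe, TensorProduct.inner_tmul]

variable (E H) in
/-- The elementary tensor as a continuous linear map in its left variable. -/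
def tmulRight (h : H) : E →L[ℂ] HilbertTensor E H :=
  LinearMap.mkContinuous
    { toFun := fun x => tmulH x h
      map_add' := fun x y => by
        simp only [tmulH, TensorProduct.add_tmul, UniformSpace.Completion.coe_add]
      map_smul' := fun c x => by
        simp only [tmulH, ← TensorProduct.smul_tmul', UniformSpace.Completion.coe_smul,
          RingHom.id_apply] } ‖h‖ fun x => by
    change ‖tmulH x h‖ ≤ _
    rw [tmulH, UniformSpace.Completion.norm_coe, TensorProduct.norm_tmul, mul_comm]

/-- The elementary tensor as a continuous linear map in its right variable. -/
def tmulLeft (H : Type*) [NormedAddCommGroup H] [InnerProductSpace ℂ H] (x : E) :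
    H →L[ℂ] HilbertTensor E H :=
  LinearMap.mkContinuous
    { toFun := fun h => tmulH x h
      map_add' := fun h k => by
        simp only [tmulH, TensorProduct.tmul_add, UniformSpace.Completion.coe_add]
      map_smul' := fun c h => by
        simp only [tmulH, TensorProduct.tmul_smul, UniformSpace.Completion.coe_smul,
          RingHom.id_apply] } ‖x‖ fun h => by
    change ‖tmulH x h‖ ≤ _
    rw [tmulH, UniformSpace.Completion.norm_coe, TensorProduct.norm_tmul]

@[simp] theorem tmulRight_apply (x : E) (h : H) : tmulRight E H h x = tmulH x h := rfl

/-- Continuous linear maps on a Hilbert space tensor product that agree on the elementary tensors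
are equal. -/
theorem hilbertTensor_ext {f g : HilbertTensor E H →L[ℂ] F}
    (hfg : ∀ x h, f (tmulH x h) = g (tmulH x h)) : f = g := by
  ext u
  induction u using UniformSpace.Completion.induction_on with
  | hp => exact isClosed_eq f.continuous g.continuous
  | ih t =>
    induction t using TensorProduct.induction_on with
    | zero => rw [UniformSpace.Completion.coe_zero, map_zero, map_zero]
    | tmul x h => exact hfg x h
    | add s t hs ht => rw [UniformSpace.Completion.coe_add, map_add, map_add, hs, ht]

/-- Vectors of a Hilbert space tensor product are separated by the elementary tensors. -/
theorem ext_inner_tmulH {u v : HilbertTensor E H}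
    (h : ∀ x k, ⟪tmulH x k, u⟫_ℂ = ⟪tmulH x k, v⟫_ℂ) : u = v := by
  have h1 : innerSL ℂ u = innerSL ℂ v := hilbertTensor_ext fun x k => by
    rw [innerSL_apply_apply, innerSL_apply_apply, ← inner_conj_symm, h, inner_conj_symm]
  refine ext_inner_right ℂ fun w => ?_
  rw [← innerSL_apply_apply ℂ, h1, innerSL_apply_apply]

theorem tensorId_comp (A : E' →L[ℂ] E'') (C : E →L[ℂ] E') :
    tensorId H (A ∘L C) = tensorId H A ∘L tensorId H C :=
  hilbertTensor_ext fun x h => by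
    simp only [tensorId_tmulH, ContinuousLinearMap.comp_apply]

theorem tensorId_tensorId (A : E' →L[ℂ] E'') (C : E →L[ℂ] E') (u : HilbertTensor E H) :
    tensorId H A (tensorId H C u) = tensorId H (A ∘L C) u := by
  rw [tensorId_comp, ContinuousLinearMap.comp_apply]

variable (E H) in
theorem tensorId_id : tensorId H (ContinuousLinearMap.id ℂ E) = ContinuousLinearMap.id ℂ _ :=
  hilbertTensor_ext fun x h => by
    simp only [tensorId_tmulH, ContinuousLinearMap.id_apply]

theorem tensorId_add (A C : E →L[ℂ] E') : tensorId H (A + C) = tensorId H A + tensorId H C :=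
  hilbertTensor_ext fun x h => by
    simp only [tensorId_tmulH, add_apply]
    exact (tmulRight E' H h).map_add _ _

theorem tensorId_smul (c : ℂ) (A : E →L[ℂ] E') : tensorId H (c • A) = c • tensorId H A :=
  hilbertTensor_ext fun x h => by
    simp only [tensorId_tmulH, smul_apply]
    exact (tmulRight E' H h).map_smul _ _

theorem adjoint_tensorId [CompleteSpace E] [CompleteSpace E'] (A : E →L[ℂ] E') :
    adjoint (tensorId H A) = tensorId H (adjoint A) :=
  hilbertTensor_ext fun x h => ext_inner_tmulH fun y k => by
    rw [ContinuousLinearMap.adjoint_inner_right, tensorId_tmulH, tensorId_tmulH, inner_tmulH,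
      inner_tmulH, ContinuousLinearMap.adjoint_inner_right]

theorem inner_tensorId_right [CompleteSpace E] [CompleteSpace E'] (A : E →L[ℂ] E')
    (u : HilbertTensor E' H) (v : HilbertTensor E H) :
    ⟪u, tensorId H A v⟫_ℂ = ⟪tensorId H (adjoint A) u, v⟫_ℂ := by
  rw [← adjoint_tensorId, ContinuousLinearMap.adjoint_inner_left]

/-! ### Slices along an orthonormal basis of the second factor -/

variable {κ : Type*}

/-- The isometry `x ↦ x ⊗ b_j`. -/
def tmulBasis (E : Type*) [NormedAddCommGroup E] [InnerProductSpace ℂ E] (b : HilbertBasis κ ℂ H)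
    (j : κ) : E →ₗᵢ[ℂ] HilbertTensor E H where
  toLinearMap := (tmulRight E H (b j)).toLinearMap
  norm_map' x := by
    change ‖tmulH x (b j)‖ = ‖x‖
    rw [tmulH, UniformSpace.Completion.norm_coe, TensorProduct.norm_tmul, b.orthonormal.1, mul_one]

@[simp] theorem tmulBasis_apply (b : HilbertBasis κ ℂ H) (j : κ) (x : E) :
    tmulBasis E b j x = tmulH x (b j) := rfl

theorem isHilbertSum_tmulBasis [CompleteSpace E] (b : HilbertBasis κ ℂ H) :
    IsHilbertSum ℂ (fun _ : κ => E) (tmulBasis E b) := by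
  refine IsHilbertSum.mk (fun i j hij x y => ?_) ?_
  · rw [tmulBasis_apply, tmulBasis_apply, inner_tmulH, b.orthonormal.2 hij, mul_zero]
  · rw [top_le_iff, Submodule.topologicalClosure_eq_top_iff, Submodule.eq_bot_iff]
    intro u hu
    have h0 : ∀ j x, ⟪tmulH x (b j), u⟫_ℂ = 0 := fun j x =>
      (Submodule.mem_orthogonal _ _).1 hu _
        (Submodule.mem_iSup_of_mem j ⟨x, rfl⟩)
    refine ext_inner_tmulH fun x k => ?_
    rw [inner_zero_right]
    -- Orthogonality to every $x\otimes b_j$ extends to every $x\otimes k$ because the $b_j$ span a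
    -- dense subspace.
    have h1 : innerSL ℂ u ∘L tmulLeft H x = 0 := by
      refine ContinuousLinearMap.ext_on
        ((Submodule.dense_iff_topologicalClosure_eq_top).2 b.dense_span) ?_
      rintro _ ⟨j, rfl⟩
      change ⟪u, tmulH x (b j)⟫_ℂ = 0
      rw [← inner_conj_symm, h0, map_zero]
    have h2 : ⟪u, tmulH x k⟫_ℂ = 0 := congrArg (fun f => f k) h1
    rw [← inner_conj_symm, h2, map_zero]

/-- The coordinates `E ⊗ H ≃ ⨁_j E` of a Hilbert space tensor product with respect to an
orthonormal basis of `H`. -/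
def slice [CompleteSpace E] (b : HilbertBasis κ ℂ H) :
    HilbertTensor E H ≃ₗᵢ[ℂ] lp (fun _ : κ => E) 2 :=
  (isHilbertSum_tmulBasis b).linearIsometryEquiv

theorem inner_slice [CompleteSpace E] (b : HilbertBasis κ ℂ H) (u : HilbertTensor E H) (j : κ)
    (y : E) : ⟪y, slice b u j⟫_ℂ = ⟪tmulH y (b j), u⟫_ℂ := by
  classical
  refine (lp.inner_single_left (𝕜 := ℂ) (G := fun _ : κ => E) j y (slice b u)).symm.trans ?_
  rw [← (slice b).symm.inner_map_map, LinearIsometryEquiv.symm_apply_apply,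
    slice, IsHilbertSum.linearIsometryEquiv_symm_apply_single, tmulBasis_apply]

/-- Moving $A\otimes I$ to the other side of the inner product leaves $b_j$ untouched, so $A\otimes
I$ is block diagonal in the slices. Both the norm estimate and the $w^*$-continuity below come from
this. -/
theorem slice_tensorId [CompleteSpace E] [CompleteSpace E'] (b : HilbertBasis κ ℂ H)
    (A : E →L[ℂ] E') (u : HilbertTensor E H) (j : κ) :
    slice b (tensorId H A u) j = A (slice b u j) :=
  ext_inner_left ℂ fun y => by
    rw [inner_slice, inner_tensorId_right, tensorId_tmulH, ← inner_slice,
      ContinuousLinearMap.adjoint_inner_left]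

theorem hasSum_norm_slice [CompleteSpace E] (b : HilbertBasis κ ℂ H) (u : HilbertTensor E H) :
    HasSum (fun j => ‖slice b u j‖ ^ 2) (‖u‖ ^ 2) := by
  have := lp.hasSum_norm (p := 2) (by norm_num) (slice b u)
  simpa using this

theorem hasSum_inner_slice [CompleteSpace E] (b : HilbertBasis κ ℂ H) (u v : HilbertTensor E H) :
    HasSum (fun j => ⟪slice b u j, slice b v j⟫_ℂ) ⟪u, v⟫_ℂ := by
  simpa using lp.hasSum_inner (𝕜 := ℂ) (G := fun _ : κ => E) (slice b u) (slice b v)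

end TensorOperators

/-! ### Maps of the form `A ↦ K^* (A ⊗ I) K` -/

section Conjugation

variable {E H H' : Type*} [NormedAddCommGroup E] [InnerProductSpace ℂ E]
  [NormedAddCommGroup H] [InnerProductSpace ℂ H]
  [NormedAddCommGroup H'] [InnerProductSpace ℂ H']

/-- The map `A ↦ K^* (A ⊗ I) K`. -/
def conjTensor [CompleteSpace H] (K : H →L[ℂ] HilbertTensor E H') : (E →L[ℂ] E) →ₗ[ℂ] (H →L[ℂ] H) where
  toFun A := adjoint K ∘L tensorId H' A ∘L K
  map_add' A C := by
    rw [tensorId_add, ContinuousLinearMap.add_comp, ContinuousLinearMap.comp_add]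
  map_smul' c A := by
    rw [tensorId_smul, ContinuousLinearMap.smul_comp, ContinuousLinearMap.comp_smul,
      RingHom.id_apply]

theorem conjTensor_apply [CompleteSpace H] (K : H →L[ℂ] HilbertTensor E H') (A : E →L[ℂ] E) :
    conjTensor K A = adjoint K ∘L tensorId H' A ∘L K := rfl

theorem blockOp_apply {m : ℕ} (M : Matrix (Fin m) (Fin m) (E →L[ℂ] E))
    (x : PiLp 2 (fun _ : Fin m => E)) (i : Fin m) : blockOp M x i = ∑ j, M i j (x j) := by
  simp [blockOp]

theorem sum_norm_blockOp_le {m : ℕ} (M : Matrix (Fin m) (Fin m) (E →L[ℂ] E)) (x : Fin m → E) :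
    ∑ i, ‖∑ j, M i j (x j)‖ ^ 2 ≤ ‖blockOp M‖ ^ 2 * ∑ j, ‖x j‖ ^ 2 := by
  have h := (blockOp M).le_opNorm (WithLp.toLp 2 x)
  have h2 := pow_le_pow_left₀ (norm_nonneg _) h 2
  rw [mul_pow, PiLp.norm_sq_eq_of_L2, PiLp.norm_sq_eq_of_L2] at h2
  simpa only [blockOp_apply] using h2

/-- The amplification `A ↦ A ⊗ I` does not increase the norm of a matrix of operators. -/
theorem sum_norm_tensorId_le [CompleteSpace E] [CompleteSpace H] {m : ℕ}
    (M : Matrix (Fin m) (Fin m) (E →L[ℂ] E)) (u : Fin m → HilbertTensor E H) :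
    ∑ i, ‖∑ j, tensorId H (M i j) (u j)‖ ^ 2 ≤ ‖blockOp M‖ ^ 2 * ∑ j, ‖u j‖ ^ 2 := by
  obtain ⟨w, b, -⟩ := exists_hilbertBasis ℂ H
  have hsl : ∀ i l, slice b (∑ j, tensorId H (M i j) (u j)) l = ∑ j, M i j (slice b (u j) l) := by
    intro i l
    rw [map_sum, lp.coeFn_sum, Finset.sum_apply]
    exact Finset.sum_congr rfl fun j _ => slice_tensorId b _ _ _
  have h1 := hasSum_sum (s := Finset.univ) fun (i : Fin m) _ =>
    hasSum_norm_slice b (∑ j, tensorId H (M i j) (u j))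
  have h2 := (hasSum_sum (s := Finset.univ) fun (j : Fin m) _ =>
    hasSum_norm_slice b (u j)).mul_left (‖blockOp M‖ ^ 2)
  -- The bound for the block operator on $E^m$ is applied in each slice $l$ and summed by Parseval.
  refine hasSum_le (fun l => ?_) h1 h2
  simp only [hsl]
  exact sum_norm_blockOp_le M fun j => slice b (u j) l

/-- $K$ and $K^*$ act on each coordinate of $H^m$ separately and are contractions, so only the
amplification $A\mapsto A\otimes I$ has to be estimated. -/
theorem isCompletelyContractive_conjTensor [CompleteSpace E] [CompleteSpace H]
    [CompleteSpace H'] {K : H →L[ℂ] HilbertTensor E H'}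
    (hK : ‖K‖ ≤ 1) : IsCompletelyContractive (conjTensor K) := by
  intro m M
  refine ContinuousLinearMap.opNorm_le_bound _ (norm_nonneg _) fun x => ?_
  refine le_of_sq_le_sq ?_ (by positivity)
  rw [mul_pow, PiLp.norm_sq_eq_of_L2, PiLp.norm_sq_eq_of_L2]
  have hK' : ‖adjoint K‖ ≤ 1 := by rwa [LinearIsometryEquiv.norm_map]
  calc ∑ i, ‖blockOp (M.map (conjTensor K)) x i‖ ^ 2
      = ∑ i, ‖adjoint K (∑ j, tensorId H' (M i j) (K (x j)))‖ ^ 2 := by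
        refine Finset.sum_congr rfl fun i _ => ?_
        rw [blockOp_apply, map_sum]
        rfl
    _ ≤ ∑ i, ‖∑ j, tensorId H' (M i j) (K (x j))‖ ^ 2 := by
        refine Finset.sum_le_sum fun i _ => pow_le_pow_left₀ (norm_nonneg _) ?_ 2
        simpa using (adjoint K).le_of_opNorm_le hK' (∑ j, tensorId H' (M i j) (K (x j)))
    _ ≤ ‖blockOp M‖ ^ 2 * ∑ j, ‖K (x j)‖ ^ 2 := sum_norm_tensorId_le M _
    _ ≤ ‖blockOp M‖ ^ 2 * ∑ j, ‖x j‖ ^ 2 := by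
        refine mul_le_mul_of_nonneg_left (Finset.sum_le_sum fun j _ => ?_) (sq_nonneg _)
        refine pow_le_pow_left₀ (norm_nonneg _) ?_ 2
        simpa using K.le_of_opNorm_le hK (x j)

/-- A functional `A ↦ ∑_j ⟨A f_j, g_j⟩` with square summable families `f`, `g` over an arbitrary
index type can be written with families over `ℕ`. -/
theorem exists_lp_nat_tsum_inner {κ : Type*} {f g : κ → E} (hf : Summable fun j => ‖f j‖ ^ 2)
    (hg : Summable fun j => ‖g j‖ ^ 2) :
    ∃ q : lp (fun _ : ℕ => E) 2 × lp (fun _ : ℕ => E) 2, ∀ A : E →L[ℂ] E,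
      ∑' n, ⟪q.2 n, A (q.1 n)⟫_ℂ = ∑' j, ⟪g j, A (f j)⟫_ℂ := by
  -- Terms with $f_j=0$ contribute nothing, and square summability makes the remaining index set
  -- countable. It is injected into `ℕ`, with both families extended by zero.
  let s : Set κ := Function.support fun j => ‖f j‖ ^ 2
  have hs : Countable s := hf.countable_support.to_subtype
  obtain ⟨t, ht⟩ := exists_injective_nat s
  have hmem : ∀ v : κ → E, (Summable fun j => ‖v j‖ ^ 2) →
      Memℓp (Function.extend t (fun j : s => v j) 0) 2 := by
    intro v hv
    refine memℓp_gen ?_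
    have h1 : (fun n => ‖Function.extend t (fun j : s => v j) 0 n‖ ^ (2 : ENNReal).toReal) =
        Function.extend t (fun j : s => ‖v j‖ ^ 2) 0 := by
      funext n
      by_cases hn : ∃ a, t a = n
      · obtain ⟨a, rfl⟩ := hn
        simp [ht.extend_apply]
      · simp [Function.extend_apply' _ _ _ hn]
    rw [h1, summable_extend_zero ht]
    exact hv.subtype s
  refine ⟨(⟨_, hmem f hf⟩, ⟨_, hmem g hg⟩), fun A => ?_⟩
  have h2 : (fun n => ⟪Function.extend t (fun j : s => g j) 0 n,
      A (Function.extend t (fun j : s => f j) 0 n)⟫_ℂ) =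
      Function.extend t (fun j : s => ⟪g j, A (f j)⟫_ℂ) 0 := by
    funext n
    by_cases hn : ∃ a, t a = n
    · obtain ⟨a, rfl⟩ := hn
      simp [ht.extend_apply]
    · simp [Function.extend_apply' _ _ _ hn]
  change ∑' n, (fun n => ⟪Function.extend t (fun j : s => g j) 0 n,
      A (Function.extend t (fun j : s => f j) 0 n)⟫_ℂ) n = _
  rw [h2, tsum_extend_zero ht]
  refine tsum_subtype_eq_of_support_subset (f := fun j => ⟪g j, A (f j)⟫_ℂ) fun j hj => ?_
  simp only [s, Function.mem_support] at hj ⊢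
  intro h0
  have h3 : f j = 0 := by simpa using h0
  exact hj (by rw [h3, map_zero, inner_zero_right])

theorem summable_norm_sq_slice [CompleteSpace E] {κ : Type*} (b : HilbertBasis κ ℂ H')
    (K : H →L[ℂ] HilbertTensor E H') (p : lp (fun _ : ℕ => H) 2) :
    Summable fun a : ℕ × κ => ‖slice b (K (p a.1)) a.2‖ ^ 2 := by
  rw [summable_prod_of_nonneg fun _ => sq_nonneg _]
  refine ⟨fun k => (hasSum_norm_slice b (K (p k))).summable, ?_⟩
  simp only [(hasSum_norm_slice b _).tsum_eq]
  have hp : Summable fun k => ‖p k‖ ^ 2 := by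
    simpa using (lp.hasSum_norm (p := 2) (by norm_num) p).summable
  refine (hp.mul_left (‖K‖ ^ 2)).of_nonneg_of_le (fun _ => sq_nonneg _) fun k => ?_
  rw [← mul_pow]
  exact pow_le_pow_left₀ (norm_nonneg _) (K.le_opNorm _) 2

/-- The pullback of a trace class functional is again one: slicing $Kx_k$ and $Ky_k$ gives square
summable families over `ℕ` times the basis, which can be reindexed by `ℕ`. -/
theorem isWeakStarContinuous_conjTensor [CompleteSpace E] [CompleteSpace H]
    [CompleteSpace H'] (K : H →L[ℂ] HilbertTensor E H') : IsWeakStarContinuous (conjTensor K) := by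
  obtain ⟨w, b, -⟩ := exists_hilbertBasis ℂ H'
  rw [IsWeakStarContinuous, continuous_induced_rng]
  refine @continuous_pi _ _ _ (weakStarTopology E) _ _ fun p => ?_
  obtain ⟨q, hq⟩ := exists_lp_nat_tsum_inner (summable_norm_sq_slice b K p.1)
    (summable_norm_sq_slice b K p.2)
  have h : ∀ A : E →L[ℂ] E, ∑' k, ⟪p.2 k, conjTensor K A (p.1 k)⟫_ℂ =
      ∑' n, ⟪q.2 n, A (q.1 n)⟫_ℂ := by
    intro A
    have hs : Summable fun a : ℕ × w =>
        ⟪slice b (K (p.2 a.1)) a.2, A (slice b (K (p.1 a.1)) a.2)⟫_ℂ := by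
      refine Summable.of_norm_bounded (((summable_norm_sq_slice b K p.2).add
        (summable_norm_sq_slice b K p.1)).mul_left ‖A‖) fun a => ?_
      have h1 := norm_inner_le_norm (𝕜 := ℂ) (slice b (K (p.2 a.1)) a.2)
        (A (slice b (K (p.1 a.1)) a.2))
      have h2 := A.le_opNorm (slice b (K (p.1 a.1)) a.2)
      have h3 := mul_le_mul_of_nonneg_left h2 (norm_nonneg (slice b (K (p.2 a.1)) a.2))
      -- With $x,y$ the two slice norms, $(x-y)^2+x^2+y^2\ge0$ is twice the needed $xy\le x^2+y^2$.
      have h4 := mul_nonneg (norm_nonneg A) (add_nonneg (sq_nonneg (‖slice b (K (p.2 a.1)) a.2‖ -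
        ‖slice b (K (p.1 a.1)) a.2‖)) (add_nonneg (sq_nonneg ‖slice b (K (p.2 a.1)) a.2‖)
        (sq_nonneg ‖slice b (K (p.1 a.1)) a.2‖)))
      linarith
    rw [hq, hs.tsum_prod]
    refine tsum_congr fun k => ?_
    rw [conjTensor_apply, ContinuousLinearMap.comp_apply, ContinuousLinearMap.adjoint_inner_right,
      ContinuousLinearMap.comp_apply, ← (hasSum_inner_slice b _ _).tsum_eq]
    simp only [slice_tensorId]
  simp only [Function.comp_def, h]
  exact (@continuous_pi_iff _ _ _ (weakStarTopology E) _ _).1 continuous_induced_dom q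

end Conjugation

/-! ### The basis of the Fock space and the creation operators -/

section FockSpace

variable {ι : Type*}

theorem creation_e (i : ι) (α : FreeMonoid ι) :
    creation i (e α) = e (FreeMonoid.of i * α) := by
  classical
  change (orthonormal_e_mul i).orthogonalFamily.linearIsometry (e α) = _
  have h : (e α : Fock ι) = lp.single 2 α (1 : ℂ) := by
    unfold e
    congr
  rw [h, OrthogonalFamily.linearIsometry_apply_single]
  simp

theorem word_one {M : Type*} [Monoid M] (T : ι → M) : word T 1 = 1 := map_one _

theorem word_mul {M : Type*} [Monoid M] (T : ι → M) (α β : FreeMonoid ι) :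
    word T (α * β) = word T α * word T β := map_mul _ _ _

theorem word_of {M : Type*} [Monoid M] (T : ι → M) (i : ι) : word T (FreeMonoid.of i) = T i :=
  FreeMonoid.lift_eval_of _ _

theorem word_creation_e (α β : FreeMonoid ι) : word creation α (e β) = e (α * β) := by
  induction α using FreeMonoid.inductionOn' generalizing β with
  | one => rw [word_one, one_mul, one_apply_eq_self]
  | of_mul i α ih =>
    rw [word_mul, word_of, mul_apply_eq_comp, ih, creation_e, mul_assoc]

theorem dense_span_e (ι : Type*) :
    Dense (Submodule.span ℂ (Set.range (e : FreeMonoid ι → Fock ι)) : Set (Fock ι)) := by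
  classical
  rw [Submodule.dense_iff_topologicalClosure_eq_top]
  have h := (HilbertBasis.ofRepr (LinearIsometryEquiv.refl ℂ (Fock ι))).dense_span
  convert! h using 4

variable {H : Type*} [NormedAddCommGroup H] [InnerProductSpace ℂ H]

/-- Vectors of `F² ⊗ H` are separated by the vectors `e_α ⊗ k`. -/
theorem ext_inner_tmulH_e {u v : HilbertTensor (Fock ι) H}
    (h : ∀ α k, ⟪tmulH (e α) k, u⟫_ℂ = ⟪tmulH (e α) k, v⟫_ℂ) : u = v := by
  refine ext_inner_tmulH fun x k => ?_
  have h1 : innerSL ℂ u ∘L tmulRight (Fock ι) H k = innerSL ℂ v ∘L tmulRight (Fock ι) H k := by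
    refine ContinuousLinearMap.ext_on (dense_span_e ι) ?_
    rintro _ ⟨α, rfl⟩
    change ⟪u, tmulH (e α) k⟫_ℂ = ⟪v, tmulH (e α) k⟫_ℂ
    rw [← inner_conj_symm, h, inner_conj_symm]
  have h2 : ⟪u, tmulH x k⟫_ℂ = ⟪v, tmulH x k⟫_ℂ := congrArg (fun f => f x) h1
  rw [← inner_conj_symm, h2, inner_conj_symm]

end FockSpace

/-! ### Words by first letter and by length -/

section Words

variable {ι : Type*}

/-- A word is empty or has a first letter. -/
def consEquiv (ι : Type*) : Unit ⊕ ι × FreeMonoid ι ≃ FreeMonoid ι where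
  toFun a := a.elim (fun _ => 1) fun p => FreeMonoid.of p.1 * p.2
  invFun α := FreeMonoid.casesOn α (Sum.inl ()) fun i β => Sum.inr (i, β)
  left_inv a := by rcases a with _ | ⟨i, β⟩ <;> rfl
  right_inv α := by rcases α with _ | ⟨i, β⟩ <;> rfl

theorem tsum_eq_one_add_tsum_cons {f : FreeMonoid ι → ℂ} (hf : Summable f) :
    ∑' α, f α = f 1 + ∑' i, ∑' β, f (FreeMonoid.of i * β) := by
  have h1 : Summable (f ∘ consEquiv ι) := (consEquiv ι).summable_iff.2 hf
  have h2 : Summable fun p : ι × FreeMonoid ι => f (FreeMonoid.of p.1 * p.2) :=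
    h1.comp_injective Sum.inr_injective
  rw [← (consEquiv ι).tsum_eq, ← h2.tsum_prod]
  refine (Summable.tsum_sum (h1.comp_injective Sum.inl_injective)
    (h1.comp_injective Sum.inr_injective)).trans ?_
  rw [tsum_fintype, Fintype.sum_unique]
  rfl

/-- A word of length `k + 1` is a letter followed by a word of length `k`. -/
def consLengthEquiv (ι : Type*) (k : ℕ) :
    ι × {α : FreeMonoid ι // α.length = k} ≃ {α : FreeMonoid ι // α.length = k + 1} where
  toFun p := ⟨FreeMonoid.of p.1 * p.2.1, by
    rw [FreeMonoid.length_mul, FreeMonoid.length_of, p.2.2, add_comm]⟩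
  invFun α := match α with
    | ⟨[], h⟩ => absurd h (Nat.succ_ne_zero k).symm
    | ⟨i :: β, h⟩ => (i, ⟨β, Nat.succ_injective h⟩)
  left_inv p := rfl
  right_inv α := by
    rcases α with ⟨_ | ⟨i, β⟩, h⟩
    · exact absurd h (Nat.succ_ne_zero k).symm
    · rfl

end Words

/-! ### Properties of the Poisson kernel -/

section PoissonKernel

variable {ι H : Type*} [NormedAddCommGroup H] [InnerProductSpace ℂ H] [CompleteSpace H]
  {T : ι → H →L[ℂ] H}

theorem adjoint_word_one (T : ι → H →L[ℂ] H) (h : H) : adjoint (word T 1) h = h := by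
  rw [word_one, ← ContinuousLinearMap.star_eq_adjoint, star_one, one_apply_eq_self]

theorem adjoint_word_mul (T : ι → H →L[ℂ] H) (α β : FreeMonoid ι) (h : H) :
    adjoint (word T (α * β)) h = adjoint (word T β) (adjoint (word T α) h) := by
  rw [word_mul, ContinuousLinearMap.mul_def, ContinuousLinearMap.adjoint_comp]
  rfl

theorem adjoint_word_cons (T : ι → H →L[ℂ] H) (i : ι) (β : FreeMonoid ι) (h : H) :
    adjoint (word T (FreeMonoid.of i * β)) h = adjoint (word T β) (adjoint (T i) h) := by
  rw [adjoint_word_mul, word_of]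

theorem hasSum_ncPoissonKernel (hT : IsRowContraction T) (h : H) :
    HasSum (fun α => tmulH (e α) (defect T hT (adjoint (word T α) h)))
      (ncPoissonKernel T hT h) :=
  (summable_poisson hT h).hasSum

theorem inner_tmulH_e_ncPoissonKernel (hT : IsRowContraction T) (β : FreeMonoid ι) (k h : H) :
    ⟪tmulH (e β) k, ncPoissonKernel T hT h⟫_ℂ = ⟪k, defect T hT (adjoint (word T β) h)⟫_ℂ := by
  have h1 := (hasSum_ncPoissonKernel hT h).mapL (innerSL ℂ (tmulH (e β) k))
  have h2 : ∀ α, α ≠ β → innerSL ℂ (tmulH (e β) k)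
      (tmulH (e α) (defect T hT (adjoint (word T α) h))) = 0 := fun α hα => by
    rw [innerSL_apply_apply, inner_tmulH, (orthonormal_e ι).2 hα.symm, zero_mul]
  have h3 := h1.unique (hasSum_single β h2)
  rw [innerSL_apply_apply, innerSL_apply_apply, inner_tmulH, inner_self_eq_norm_sq_to_K,
    (orthonormal_e ι).1 β] at h3
  simpa using h3

/-- The Poisson kernel intertwines `T_α^*` and `S_α^* ⊗ I`. -/
theorem tensorId_adjoint_word_creation (hT : IsRowContraction T) (α : FreeMonoid ι) (h : H) :
    tensorId H (adjoint (word creation α)) (ncPoissonKernel T hT h) =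
      ncPoissonKernel T hT (adjoint (word T α) h) :=
  ext_inner_tmulH_e fun β k => by
    rw [inner_tensorId_right, ContinuousLinearMap.adjoint_adjoint, tensorId_tmulH, word_creation_e,
      -- The $\beta$-coordinate of the left side is the $\alpha\beta$-coordinate of the kernel, and
      -- $T_{\alpha\beta}^*=T_\beta^*T_\alpha^*$.
      inner_tmulH_e_ncPoissonKernel, inner_tmulH_e_ncPoissonKernel, adjoint_word_mul]

theorem adjoint_defect (hT : IsRowContraction T) : adjoint (defect T hT) = defect T hT :=
  (IsSelfAdjoint.of_nonneg (CFC.sqrt_nonneg _)).star_eq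

theorem norm_columnOp_le (hT : IsRowContraction T) (h : H) : ‖columnOp T hT h‖ ≤ ‖h‖ := by
  simpa using (columnOp T hT).le_of_opNorm_le (LinearMap.mkContinuous_norm_le _ zero_le_one _) h

theorem hasSum_norm_columnOp (hT : IsRowContraction T) (h : H) :
    HasSum (fun i => ‖adjoint (T i) h‖ ^ 2) (‖columnOp T hT h‖ ^ 2) := by
  have := lp.hasSum_norm (p := 2) (by norm_num) (columnOp T hT h)
  simp only [ENNReal.toReal_ofNat, Real.rpow_ofNat] at this
  exact this

/-- This is $\langle h,\Delta^2h\rangle$ with $\Delta^2=I-TT^*$. The telescoping needs equality with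
the full column norm, not just a bound for finite partial sums. -/
theorem norm_defect_sq_add (hT : IsRowContraction T) (h : H) :
    ‖defect T hT h‖ ^ 2 + ‖columnOp T hT h‖ ^ 2 = ‖h‖ ^ 2 := by
  have h0 : adjoint (rowOp T hT) = columnOp T hT := ContinuousLinearMap.adjoint_adjoint _
  have hin : ∀ x, ⟪x, (1 - rowOp T hT ∘L adjoint (rowOp T hT)) x⟫_ℂ =
      ((‖x‖ ^ 2 - ‖columnOp T hT x‖ ^ 2 : ℝ) : ℂ) := fun x => by
    rw [h0, sub_apply, one_apply_eq_self, inner_sub_right, ContinuousLinearMap.comp_apply, rowOp,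
      ContinuousLinearMap.adjoint_inner_right, inner_self_eq_norm_sq_to_K,
      inner_self_eq_norm_sq_to_K]
    push_cast
    rfl
  have hpos : 0 ≤ 1 - rowOp T hT ∘L adjoint (rowOp T hT) := by
    rw [ContinuousLinearMap.nonneg_iff_isPositive, ContinuousLinearMap.isPositive_iff_complex]
    intro x
    rw [← inner_conj_symm, hin, Complex.conj_ofReal]
    refine ⟨rfl, ?_⟩
    have : ‖columnOp T hT x‖ ^ 2 ≤ ‖x‖ ^ 2 :=
      pow_le_pow_left₀ (norm_nonneg _) (norm_columnOp_le hT x) 2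
    change (0 : ℝ) ≤ ‖x‖ ^ 2 - ‖columnOp T hT x‖ ^ 2
    linarith
  have h5 : ⟪h, (defect T hT * defect T hT) h⟫_ℂ = ((‖defect T hT h‖ ^ 2 : ℝ) : ℂ) := by
    rw [mul_apply_eq_comp, ← ContinuousLinearMap.adjoint_inner_left, adjoint_defect,
      inner_self_eq_norm_sq_to_K]
    push_cast
    rfl
  rw [defect, CFC.sqrt_mul_sqrt_self _ hpos, hin] at h5
  have h6 := Complex.ofReal_injective h5
  rw [defect, ← h6, sub_add_cancel]

/-! ### The Poisson kernel of a `C_0`-contraction is an isometry -/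

/-- The sum of `f (T_α^* h)` over the words `α` of length `k`. -/
def wordSum (T : ι → H →L[ℂ] H) (f : H → ENNReal) (k : ℕ) (h : H) : ENNReal :=
  ∑' α : {α : FreeMonoid ι // α.length = k}, f (adjoint (word T α.1) h)

theorem wordSum_zero (T : ι → H →L[ℂ] H) (f : H → ENNReal) (h : H) : wordSum T f 0 h = f h := by
  have : Unique {α : FreeMonoid ι // α.length = 0} :=
    ⟨⟨⟨1, rfl⟩⟩, fun α => Subtype.ext (FreeMonoid.length_eq_zero.1 α.2)⟩
  rw [wordSum, tsum_fintype, Fintype.sum_unique]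
  change f (adjoint (word T (default : {α : FreeMonoid ι // α.length = 0}).1) h) = _
  rw [FreeMonoid.length_eq_zero.1 (default : {α : FreeMonoid ι // α.length = 0}).2,
    adjoint_word_one]

/-- Splits off the first letter, using $T_{g_i\beta}^*=T_\beta^*T_i^*$. With values in $[0,\infty]$
the regrouping needs no summability. -/
theorem wordSum_succ (T : ι → H →L[ℂ] H) (f : H → ENNReal) (k : ℕ) (h : H) :
    wordSum T f (k + 1) h = ∑' i, wordSum T f k (adjoint (T i) h) := by
  simp only [wordSum]
  rw [← (consLengthEquiv ι k).tsum_eq, ← ENNReal.tsum_prod]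
  refine tsum_congr fun p => ?_
  rw [← adjoint_word_cons]
  rfl

theorem tsum_freeMonoid_eq (T : ι → H →L[ℂ] H) (f : H → ENNReal) (h : H) :
    ∑' α, f (adjoint (word T α) h) = ∑' k, wordSum T f k h := by
  rw [← (Equiv.sigmaFiberEquiv (FreeMonoid.length : FreeMonoid ι → ℕ)).tsum_eq]
  exact ENNReal.tsum_sigma fun (k : ℕ) (α : {α : FreeMonoid ι // α.length = k}) =>
    f (adjoint (word T α.1) h)

/-- One telescoping step. Length $0$ is the defect identity at $h$; the induction applies the
previous length to each $T_i^*h$. -/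
theorem wordSum_norm_eq (hT : IsRowContraction T) (k : ℕ) (h : H) :
    wordSum T (fun x => ENNReal.ofReal (‖x‖ ^ 2)) k h =
      wordSum T (fun x => ENNReal.ofReal (‖defect T hT x‖ ^ 2)) k h +
        wordSum T (fun x => ENNReal.ofReal (‖x‖ ^ 2)) (k + 1) h := by
  induction k generalizing h with
  | zero =>
    rw [wordSum_succ]
    simp only [wordSum_zero]
    rw [← ENNReal.ofReal_tsum_of_nonneg (fun _ => sq_nonneg _)
      (hasSum_norm_columnOp hT h).summable, (hasSum_norm_columnOp hT h).tsum_eq,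
      ← ENNReal.ofReal_add (sq_nonneg _) (sq_nonneg _), norm_defect_sq_add]
  | succ k ih =>
    rw [wordSum_succ, wordSum_succ _ _ k, wordSum_succ _ _ (k + 1), ← ENNReal.tsum_add]
    exact tsum_congr fun i => ih _

theorem sum_wordSum_add (hT : IsRowContraction T) (k : ℕ) (h : H) :
    ∑ j ∈ Finset.range k, wordSum T (fun x => ENNReal.ofReal (‖defect T hT x‖ ^ 2)) j h +
      wordSum T (fun x => ENNReal.ofReal (‖x‖ ^ 2)) k h = ENNReal.ofReal (‖h‖ ^ 2) := by
  induction k with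
  | zero => rw [Finset.sum_range_zero, zero_add, wordSum_zero]
  | succ k ih => rw [Finset.sum_range_succ, add_assoc, ← wordSum_norm_eq, ih]

theorem isRowContraction_of_sum_le {κ : Type*} {R : κ → H →L[ℂ] H}
    (hR : ∀ (s : Finset κ) (h : H), ∑ i ∈ s, ‖adjoint (R i) h‖ ^ 2 ≤ ‖h‖ ^ 2) :
    IsRowContraction R := by
  intro s
  rw [ContinuousLinearMap.le_def, ContinuousLinearMap.isPositive_iff_complex]
  intro h
  have h1 : ⟪(1 - ∑ i ∈ s, R i ∘L adjoint (R i)) h, h⟫_ℂ =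
      ((‖h‖ ^ 2 - ∑ i ∈ s, ‖adjoint (R i) h‖ ^ 2 : ℝ) : ℂ) := by
    have h2 : ∀ i, ⟪R i (adjoint (R i) h), h⟫_ℂ = ((‖adjoint (R i) h‖ ^ 2 : ℝ) : ℂ) := fun i => by
      rw [← ContinuousLinearMap.adjoint_inner_right, inner_self_eq_norm_sq_to_K]
      push_cast
      rfl
    simp only [sub_apply, one_apply_eq_self, sum_apply, ContinuousLinearMap.comp_apply,
      inner_sub_left, sum_inner, h2, inner_self_eq_norm_sq_to_K]
    push_cast
    rfl
  rw [h1]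
  refine ⟨rfl, ?_⟩
  change (0 : ℝ) ≤ ‖h‖ ^ 2 - ∑ i ∈ s, ‖adjoint (R i) h‖ ^ 2
  linarith [hR s h]

/-- The words of a fixed length in a row contraction form a row contraction. -/
theorem isRowContraction_word (hT : IsRowContraction T) (k : ℕ) :
    IsRowContraction fun α : {α : FreeMonoid ι // α.length = k} => word T α.1 := by
  refine isRowContraction_of_sum_le fun s h => ?_
  -- The sum over words of length $k$ is one nonnegative summand of the telescoped identity for
  -- $\|h\|^2$.
  rw [← ENNReal.ofReal_le_ofReal_iff (sq_nonneg _),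
    ENNReal.ofReal_sum_of_nonneg fun _ _ => sq_nonneg _, ← sum_wordSum_add hT k h]
  exact (ENNReal.sum_le_tsum s).trans le_add_self

/-- Connects the numerical remainder with the vector series in the $C_0$ condition. That series must
be shown to converge, since otherwise its `tsum` would be $0$ by default; it does because the words
of length $k$ form a row contraction $R$, and its sum is $RR^*h$. -/
theorem wordSum_norm_eq_inner (hT : IsRowContraction T) (k : ℕ) (h : H) :
    wordSum T (fun x => ENNReal.ofReal (‖x‖ ^ 2)) k h =
      ENNReal.ofReal (RCLike.re ⟪h, ∑' α : {α : FreeMonoid ι // α.length = k},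
        (word T α.1) (adjoint (word T α.1) h)⟫_ℂ) := by
  have hR := isRowContraction_word hT k
  have h1 := hasSum_rowOp hR (columnOp _ hR h)
  have h2 : HasSum (fun α : {α : FreeMonoid ι // α.length = k} =>
      (word T α.1) (adjoint (word T α.1) h)) (rowOp _ hR (columnOp _ hR h)) := h1
  rw [h2.tsum_eq, rowOp, ContinuousLinearMap.adjoint_inner_right, inner_self_eq_norm_sq,
    ← (hasSum_norm_columnOp hR h).tsum_eq,
    ENNReal.ofReal_tsum_of_nonneg (fun _ => sq_nonneg _) (hasSum_norm_columnOp hR h).summable]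
  rfl

/-- Parseval for the mutually orthogonal subspaces $e_\alpha\otimes H$, with the words grouped by
length. -/
theorem norm_ncPoissonKernel_sq (hT : IsRowContraction T) (h : H) :
    ENNReal.ofReal (‖ncPoissonKernel T hT h‖ ^ 2) =
      ∑' k, wordSum T (fun x => ENNReal.ofReal (‖defect T hT x‖ ^ 2)) k h := by
  have h1 : ‖ncPoissonKernel T hT h‖ = ‖poissonCoeff hT h‖ :=
    orthogonalFamily_basisTensor.linearIsometry.norm_map (poissonCoeff hT h)
  have h2 := lp.hasSum_norm (p := 2) (by norm_num) (poissonCoeff hT h)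
  simp only [ENNReal.toReal_ofNat, Real.rpow_ofNat] at h2
  rw [h1, ← h2.tsum_eq, ENNReal.ofReal_tsum_of_nonneg (fun _ => sq_nonneg _) h2.summable]
  exact tsum_freeMonoid_eq T (fun x => ENNReal.ofReal (‖defect T hT x‖ ^ 2)) h

theorem norm_ncPoissonKernel (hT : IsC0Contraction T) (h : H) :
    ‖ncPoissonKernel T hT.isRowContraction h‖ = ‖h‖ := by
  have hR := hT.isRowContraction
  have h1 : Filter.Tendsto (fun k => wordSum T (fun x => ENNReal.ofReal (‖x‖ ^ 2)) k h)
      Filter.atTop (𝓝 0) := by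
    simp only [wordSum_norm_eq_inner hR]
    have h2 := (((innerSL ℂ h).continuous.tendsto 0).comp (hT.tendsto_zero h))
    have h3 := ENNReal.tendsto_ofReal ((RCLike.continuous_re.tendsto _).comp h2)
    simpa using h3
  have h4 := (ENNReal.tendsto_nat_tsum
    fun j => wordSum T (fun x => ENNReal.ofReal (‖defect T hR x‖ ^ 2)) j h).add h1
  simp only [sum_wordSum_add hR, add_zero] at h4
  have h5 := tendsto_nhds_unique h4 tendsto_const_nhds
  rw [← norm_ncPoissonKernel_sq, ENNReal.ofReal_eq_ofReal_iff (sq_nonneg _) (sq_nonneg _)] at h5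
  exact (sq_eq_sq₀ (norm_nonneg _) (norm_nonneg _)).1 h5

end PoissonKernel

/-! ### The Poisson kernel and the annihilating ideal -/

section Ideal

variable {ι H : Type*} [NormedAddCommGroup H] [InnerProductSpace ℂ H] [CompleteSpace H]
  {T : ι → H →L[ℂ] H}

/-- `e_1 ⊗ Δ k` lies in the closed span of `K k` and the vectors `(S_i ⊗ I) K T_i^* k`. -/
theorem inner_tmulH_e_one_eq_zero (hT : IsRowContraction T) {w : HilbertTensor (Fock ι) H}
    (h1 : ∀ k, ⟪w, ncPoissonKernel T hT k⟫_ℂ = 0)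
    (h2 : ∀ i k, ⟪w, tensorId H (creation i) (ncPoissonKernel T hT k)⟫_ℂ = 0) (k : H) :
    ⟪w, tmulH (e 1) (defect T hT k)⟫_ℂ = 0 := by
  have h3 := (hasSum_ncPoissonKernel hT k).mapL (innerSL ℂ w)
  -- The terms with first letter $g_i$ add up to $\langle w,(S_i\otimes I)K_TT_i^*k\rangle=0$.
  -- Pairing with $w$ makes the series scalar, so it may be regrouped by first letter.
  have h4 : ∀ i, ∑' β, innerSL ℂ w (tmulH (e (FreeMonoid.of i * β))
      (defect T hT (adjoint (word T (FreeMonoid.of i * β)) k))) = 0 := fun i => by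
    have h5 := (hasSum_ncPoissonKernel hT (adjoint (T i) k)).mapL
      (innerSL ℂ w ∘L tensorId H (creation i))
    rw [ContinuousLinearMap.comp_apply, innerSL_apply_apply, h2] at h5
    rw [← h5.tsum_eq]
    refine tsum_congr fun β => ?_
    rw [ContinuousLinearMap.comp_apply, tensorId_tmulH, creation_e, adjoint_word_cons]
  have h6 := h3.tsum_eq
  rw [tsum_eq_one_add_tsum_cons h3.summable, tsum_congr h4, tsum_zero, add_zero,
    innerSL_apply_apply, innerSL_apply_apply, h1, adjoint_word_one] at h6
  exact h6

/-- The Poisson kernel takes values in `F²` tensored with the closure of the range of `Δ`. -/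
theorem inner_tmulH_eq_zero_of_defect (hT : IsRowContraction T) {x : Fock ι} {h : H}
    (hx : ∀ k, ⟪ncPoissonKernel T hT h, tmulH x (defect T hT k)⟫_ℂ = 0) (k : H) :
    ⟪ncPoissonKernel T hT h, tmulH x k⟫_ℂ = 0 := by
  -- The vector $v$ represents $y\mapsto\langle K_Th,x\otimes y\rangle$. It is orthogonal to the
  -- range of $\Delta$, so every term of $\langle x\otimes v,K_Th\rangle$ vanishes; hence $\langle
  -- v,v\rangle=0$.
  let v : H := adjoint (tmulLeft H x) (ncPoissonKernel T hT h)
  have hv : ∀ y, ⟪v, y⟫_ℂ = ⟪ncPoissonKernel T hT h, tmulH x y⟫_ℂ := fun y =>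
    ContinuousLinearMap.adjoint_inner_left _ _ _
  have h1 := (hasSum_ncPoissonKernel hT h).mapL (innerSL ℂ (tmulH x v))
  have h2 : ∀ α, innerSL ℂ (tmulH x v)
      (tmulH (e α) (defect T hT (adjoint (word T α) h))) = 0 := fun α => by
    rw [innerSL_apply_apply, inner_tmulH, hv, hx, mul_zero]
  simp only [h2] at h1
  have h3 : ⟪v, v⟫_ℂ = 0 := by
    rw [hv, ← inner_conj_symm, ← innerSL_apply_apply ℂ, h1.unique hasSum_zero, map_zero]
  rw [← hv, inner_self_eq_zero.1 h3, inner_zero_left]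

theorem inner_ncPoissonTransform (hT : IsRowContraction T) (A : Fock ι →L[ℂ] Fock ι) (h k : H) :
    ⟪h, ncPoissonTransform T hT A k⟫_ℂ =
      ⟪ncPoissonKernel T hT h, tensorId H A (ncPoissonKernel T hT k)⟫_ℂ := by
  rw [ncPoissonTransform, ContinuousLinearMap.comp_apply, ContinuousLinearMap.adjoint_inner_right,
    ContinuousLinearMap.comp_apply]

/-- If the Poisson transform annihilates `A` and all `A S_i`, then the range of the Poisson kernel
is orthogonal to `A e_1 ⊗ H`. -/
theorem inner_tmulH_apply_e_one_eq_zero (hT : IsRowContraction T) {A : Fock ι →L[ℂ] Fock ι}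
    (hA : ncPoissonTransform T hT A = 0) (hAS : ∀ i, ncPoissonTransform T hT (A ∘L creation i) = 0)
    (h k : H) : ⟪ncPoissonKernel T hT h, tmulH (A (e 1)) k⟫_ℂ = 0 := by
  refine inner_tmulH_eq_zero_of_defect hT (fun y => ?_) k
  -- With $w=(A^*\otimes I)K_Th$, the two conditions on $w$ are matrix coefficients of the Poisson
  -- transforms of $A$ and $AS_i$.
  rw [← tensorId_tmulH, inner_tensorId_right]
  refine inner_tmulH_e_one_eq_zero hT (fun z => ?_) (fun i z => ?_) y
  · rw [← inner_tensorId_right, ← inner_ncPoissonTransform, hA, zero_apply, inner_zero_right]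
  · rw [← inner_tensorId_right, tensorId_tensorId, ← inner_ncPoissonTransform, hAS, zero_apply,
      inner_zero_right]

/-- The creation operators as elements of `F^∞`. -/
def creationInf (i : ι) : FInf ι :=
  ⟨ContinuousLinearMapWOT.ofCLM (creation i), Subalgebra.le_topologicalClosure _
    ⟨creation i, Subalgebra.le_topologicalClosure _
      (Algebra.subset_adjoin (Set.mem_range_self i)), rfl⟩⟩

theorem toCLM_word_creationInf (α : FreeMonoid ι) :
    ((word creationInf α : FInf ι) : Fock ι →WOT[ℂ] Fock ι).toCLM = word creation α := by
  induction α using FreeMonoid.inductionOn' with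
  | one => rw [word_one, word_one]; rfl
  | of_mul i α ih =>
    rw [word_mul, word_mul, word_of, word_of, ← ih]
    rfl

variable {J : TwoSidedIdeal (FInf ι)}

/-- All $\varphi S_\alpha$ lie in $J$, so their Poisson transforms vanish. This settles
$\psi=e_\alpha=S_\alpha e_1$, and the $e_\alpha$ span a dense subspace. -/
theorem inner_tmulH_ideal_eq_zero (hT : IsC0Contraction T) (hJT : ∀ φ ∈ J, evalAt T hT φ = 0)
    {φ : FInf ι} (hφ : φ ∈ J) (ψ : Fock ι) (h k : H) :
    ⟪ncPoissonKernel T hT.isRowContraction h,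
      tmulH ((φ : Fock ι →WOT[ℂ] Fock ι) ψ) k⟫_ℂ = 0 := by
  let A : Fock ι →L[ℂ] Fock ι := (φ : Fock ι →WOT[ℂ] Fock ι).toCLM
  have hA : ∀ α, ncPoissonTransform T hT.isRowContraction (A ∘L word creation α) = 0 := fun α => by
    rw [← toCLM_word_creationInf]
    exact hJT (φ * word creationInf α) (J.mul_mem_right _ _ hφ)
  have h1 : innerSL ℂ (ncPoissonKernel T hT.isRowContraction h) ∘L
      tmulRight (Fock ι) H k ∘L A = 0 := by
    refine ContinuousLinearMap.ext_on (dense_span_e ι) ?_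
    rintro _ ⟨α, rfl⟩
    have h2 := inner_tmulH_apply_e_one_eq_zero hT.isRowContraction (hA α) (fun i => ?_) h k
    · rw [ContinuousLinearMap.comp_apply, word_creation_e, mul_one] at h2
      exact h2
    · have h3 := hA (α * FreeMonoid.of i)
      rw [word_mul, word_of] at h3
      exact h3
  exact congrArg (fun f => f ψ) h1

theorem inner_tmulH_MJ_eq_zero (hT : IsC0Contraction T) (hJT : ∀ φ ∈ J, evalAt T hT φ = 0)
    {x : Fock ι} (hx : x ∈ MJ J) (h k : H) :
    ⟪ncPoissonKernel T hT.isRowContraction h, tmulH x k⟫_ℂ = 0 := by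
  let f := innerSL ℂ (ncPoissonKernel T hT.isRowContraction h) ∘L tmulRight (Fock ι) H k
  have h1 : MJ J ≤ f.ker := by
    refine Submodule.topologicalClosure_minimal _ (Submodule.span_le.2 ?_) f.isClosed_ker
    rintro _ ⟨φ, hφ, ψ, rfl⟩
    exact inner_tmulH_ideal_eq_zero hT hJT hφ ψ h k
  exact h1 hx

theorem creation_mem_MJ (i : ι) {x : Fock ι} (hx : x ∈ MJ J) : creation i x ∈ MJ J := by
  have h1 : MJ J ≤ (MJ J).comap (creation i).toLinearMap := by
    refine Submodule.topologicalClosure_minimal _ (Submodule.span_le.2 ?_)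
      ((Submodule.isClosed_topologicalClosure _).preimage (creation i).continuous)
    rintro _ ⟨φ, hφ, ψ, rfl⟩
    exact Submodule.le_topologicalClosure _ (Submodule.subset_span
      ⟨creationInf i * φ, J.mul_mem_left _ _ hφ, ψ, rfl⟩)
  exact h1 hx

theorem adjoint_creation_mem_NJ (i : ι) {x : Fock ι} (hx : x ∈ NJ J) :
    adjoint (creation i) x ∈ NJ J := by
  rw [Submodule.mem_orthogonal] at hx ⊢
  intro y hy
  rw [ContinuousLinearMap.adjoint_inner_right]
  exact hx _ (creation_mem_MJ i hy)

/-- $J$ is also a left ideal, so $\mathcal M_J$ is $S_i$-invariant and $\mathcal N_J$ is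
$S_i^*$-invariant; no projection is left in the adjoint of the compression. -/
theorem coe_adjoint_B (i : ι) (x : NJ J) :
    ((adjoint (B J i) x : NJ J) : Fock ι) = adjoint (creation i) (x : Fock ι) := by
  have h1 : adjoint (B J i) x = ⟨_, adjoint_creation_mem_NJ i x.2⟩ := by
    refine ext_inner_left ℂ fun y => ?_
    rw [ContinuousLinearMap.adjoint_inner_right, B, compression,
      ContinuousLinearMap.comp_apply, ContinuousLinearMap.comp_apply,
      Submodule.inner_orthogonalProjectionOnto_eq_of_mem_right,
      ← ContinuousLinearMap.adjoint_inner_right]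
    rfl
  rw [h1]

theorem coe_adjoint_word_B (α : FreeMonoid ι) (x : NJ J) :
    ((adjoint (word (B J) α) x : NJ J) : Fock ι) =
      adjoint (word creation α) (x : Fock ι) := by
  induction α using FreeMonoid.inductionOn' generalizing x with
  | one => rw [adjoint_word_one, adjoint_word_one]
  | of_mul i α ih => rw [adjoint_word_cons, adjoint_word_cons, ih, coe_adjoint_B]

/-- The Poisson kernel regarded as a map into `N_J ⊗ H`. -/
def constrainedKernel (T : ι → H →L[ℂ] H) (hT : IsRowContraction T) (J : TwoSidedIdeal (FInf ι)) :
    H →L[ℂ] HilbertTensor (NJ J) H :=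
  tensorId H (NJ J).orthogonalProjectionOnto ∘L ncPoissonKernel T hT

/-- This is the precise sense in which $K_T$ takes values in $\mathcal N_J\otimes\mathcal H$. Tested
against $x\otimes k$, the two sides differ by the pairing of $K_Th$ with $(Px-x)\otimes k$, where
$Px-x\in\mathcal M_J$. -/
theorem tensorId_subtypeL_constrainedKernel (hT : IsC0Contraction T)
    (hJT : ∀ φ ∈ J, evalAt T hT φ = 0) (h : H) :
    tensorId H (NJ J).subtypeL (constrainedKernel T hT.isRowContraction J h) =
      ncPoissonKernel T hT.isRowContraction h := by
  refine ext_inner_tmulH fun x k => ?_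
  rw [constrainedKernel, ContinuousLinearMap.comp_apply, inner_tensorId_right,
    inner_tensorId_right, Submodule.adjoint_subtypeL, Submodule.adjoint_orthogonalProjectionOnto,
    tensorId_tmulH, tensorId_tmulH, ← sub_eq_zero, ← inner_sub_left]
  have h1 := (tmulRight (Fock ι) H k).map_sub
    ((NJ J).subtypeL ((NJ J).orthogonalProjectionOnto x)) x
  simp only [tmulRight_apply] at h1
  rw [← h1, ← inner_conj_symm, inner_tmulH_MJ_eq_zero hT hJT _ h k, map_zero]
  -- Closedness gives $\mathcal M_J^{\perp\perp}=\mathcal M_J$, which places $x-Px$ in $\mathcal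
  -- M_J$.
  have h2 : IsClosed (MJ J : Set (Fock ι)) := Submodule.isClosed_topologicalClosure _
  have h3 : CompleteSpace (MJ J) := h2.completeSpace_coe
  have h4 := (NJ J).sub_starProjection_mem_orthogonal x
  rw [Submodule.orthogonal_orthogonal] at h4
  have h5 := (MJ J).neg_mem h4
  rw [neg_sub] at h5
  exact h5

theorem tensorId_subtypeL_injective {G : Type*} [NormedAddCommGroup G] [InnerProductSpace ℂ G]
    (J : TwoSidedIdeal (FInf ι)) : Function.Injective (tensorId G (NJ J).subtypeL) := by
  intro u v huv
  have h1 := congrArg (tensorId G (NJ J).orthogonalProjectionOnto) huv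
  have h2 : (NJ J).orthogonalProjectionOnto ∘L (NJ J).subtypeL =
      ContinuousLinearMap.id ℂ (NJ J) := by
    ext1 x
    exact (NJ J).orthogonalProjectionOnto_mem_subspace_eq_self x
  simpa only [tensorId_tensorId, h2, tensorId_id, ContinuousLinearMap.id_apply] using h1

/-- After the injective inclusion into $\mathcal F^2\otimes\mathcal H$, where $B_\alpha^*$ becomes
$S_\alpha^*$, this is the intertwining relation of $K_T$. -/
theorem tensorId_adjoint_word_B (hT : IsC0Contraction T) (hJT : ∀ φ ∈ J, evalAt T hT φ = 0)
    (α : FreeMonoid ι) (h : H) :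
    tensorId H (adjoint (word (B J) α)) (constrainedKernel T hT.isRowContraction J h) =
      constrainedKernel T hT.isRowContraction J (adjoint (word T α) h) := by
  apply tensorId_subtypeL_injective J
  have h1 : (NJ J).subtypeL ∘L adjoint (word (B J) α) =
      adjoint (word creation α) ∘L (NJ J).subtypeL := by
    ext1 x
    exact coe_adjoint_word_B α x
  rw [tensorId_tensorId, h1, ← tensorId_tensorId, tensorId_subtypeL_constrainedKernel hT hJT,
    tensorId_subtypeL_constrainedKernel hT hJT, tensorId_adjoint_word_creation]

theorem inner_constrainedKernel (hT : IsC0Contraction T) (hJT : ∀ φ ∈ J, evalAt T hT φ = 0)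
    (h k : H) : ⟪constrainedKernel T hT.isRowContraction J h,
      constrainedKernel T hT.isRowContraction J k⟫_ℂ = ⟪h, k⟫_ℂ := by
  have h1 := (ContinuousLinearMap.inner_map_map_iff_adjoint_comp_self _).2
    ((ContinuousLinearMap.norm_map_iff_adjoint_comp_self _).1 (norm_ncPoissonKernel hT)) h k
  nth_rewrite 1 [constrainedKernel]
  rw [← h1, ContinuousLinearMap.comp_apply, ← Submodule.adjoint_subtypeL,
    ← inner_tensorId_right, tensorId_subtypeL_constrainedKernel hT hJT]

end Ideal

end Popescu

end

theorem theorem3p7 {ι : Type*} [Countable ι] [Nonempty ι]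
    {H : Type*} [NormedAddCommGroup H] [InnerProductSpace ℂ H] [CompleteSpace H]
    (T : ι → H →L[ℂ] H) (hT : IsC0Contraction T)
    (J : TwoSidedIdeal (FInf ι)) (hJ : IsClosed (J : Set (FInf ι)))
    (hJT : ∀ φ ∈ J, evalAt T hT φ = 0) :
    ∃ Φ : (NJ J →L[ℂ] NJ J) →ₗ[ℂ] (H →L[ℂ] H),
      Φ 1 = 1 ∧
      IsCompletelyContractive Φ ∧
      IsWeakStarContinuous Φ ∧
      (∀ α β : FreeMonoid ι,
        Φ (word (B J) α * adjoint (word (B J) β)) = word T α * adjoint (word T β)) ∧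
      ∃ K : H →L[ℂ] HilbertTensor (NJ J) H,
        (∀ h : H, tensorId H (NJ J).subtypeL (K h) = ncPoissonKernel T hT.isRowContraction h) ∧
        ∀ A : NJ J →L[ℂ] NJ J, Φ A = adjoint K ∘L tensorId H A ∘L K := by
  let K := constrainedKernel T hT.isRowContraction J
  have hK : ∀ h k, ⟪K h, K k⟫_ℂ = ⟪h, k⟫_ℂ := inner_constrainedKernel hT hJT
  have hnorm : ‖K‖ ≤ 1 := by
    have h1 := (ContinuousLinearMap.norm_map_iff_adjoint_comp_self K).2
      ((ContinuousLinearMap.inner_map_map_iff_adjoint_comp_self K).1 hK)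
    exact K.opNorm_le_bound zero_le_one fun x => by rw [h1, one_mul]
  have hword : ∀ α β : FreeMonoid ι,
      conjTensor K (word (B J) α * adjoint (word (B J) β)) = word T α * adjoint (word T β) := by
    intro α β
    ext1 h
    refine ext_inner_left ℂ fun k => ?_
    -- Here $\langle(B_\alpha^*\otimes I)Kk,(B_\beta^*\otimes I)Kh\rangle=\langle
    -- KT_\alpha^*k,KT_\beta^*h\rangle=\langle T_\alpha^*k,T_\beta^*h\rangle$.
    rw [conjTensor_apply, ContinuousLinearMap.comp_apply, ContinuousLinearMap.adjoint_inner_right,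
      ContinuousLinearMap.comp_apply, ContinuousLinearMap.mul_def, ← tensorId_tensorId,
      inner_tensorId_right, tensorId_adjoint_word_B hT hJT, tensorId_adjoint_word_B hT hJT, hK,
      ContinuousLinearMap.adjoint_inner_left, mul_apply_eq_comp]
  refine ⟨conjTensor K, ?_, isCompletelyContractive_conjTensor hnorm,
    isWeakStarContinuous_conjTensor K, hword, K, tensorId_subtypeL_constrainedKernel hT hJT,
    fun A => rfl⟩
  -- Unitality is the case of two empty words.
  have h1 := hword 1 1
  rw [word_one, word_one, ← ContinuousLinearMap.star_eq_adjoint,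
    ← ContinuousLinearMap.star_eq_adjoint, star_one, star_one, one_mul, one_mul] at h1
  exact h1
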